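/- All graphs are finite and simple. A graph is distance-hereditary if for each of its connected induced subgraphs $H$, any two vertices of $H$ have the same distance in $H$ as in the whole graph; $\mathrm{DH}\cap\mathrm{co\text{-}DH}$ is the class of graphs $G$ such that both $G$ and its complement $\overline{G}$ are distance-hereditary. Two distinct vertices $u,v$ are twins if $N(u)\setminus\{u,v\}=N(v)\setminus\{u,v\}$; a twin elimination deletes a vertex that has a twin. The Bull is the graph on five vertices consisting of a triangle with two pendant vertices attached to two different vertices of the triangle. A module of $G=(V,E)$ is a set $M\subseteq V$ such that $N(v)\cap M\in\{M,\varnothing\}$ for every $v\in V\setminus M$; a nonempty module $M$ is strong if every module $M'$ satisfies $M\cap M'=\varnothing$, $M\subseteq M'$ or $M'\subseteq M$. The modular decomposition tree of $G$ is the rooted tree whose nodes are the strong modules of $G$ ordered by inclusion: the root is $V$, the leaves are the singletons, and the children of a node are the maximal strong modules properly contained in it. Each internal node is labelled by the quotient graph on its children, in which two children are adjacent iff their vertices are adjacent in $G$. Theorem. Let $G$ be a graph. (1) $G\in\mathrm{DH}\cap\mathrm{co\text{-}DH}$ if and only if some (possibly empty) sequence of twin eliminations transforms $G$ into a graph isomorphic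 to an induced subgraph of the Bull. (2) $G\in\mathrm{DH}\cap\mathrm{co\text{-}DH}$ if and only if, in the modular decomposition tree of $G$, the root (if it is an internal node) is labelled by an induced subgraph of the Bull, a clique or an independent set, and every other internal node is labelled by a clique or an independent set. -/

import Mathlib

namespace DHCoDH

/-- A graph is distance-hereditary if its connected induced subgraphs preserve distances. -/
def IsDistanceHereditary {V : Type*} (G : SimpleGraph V) : Prop :=
  ∀ S : Set V, (G.induce S).Connected →
    ∀ u v : S, (G.induce S).dist u v = G.dist (u : V) (v : V)

/-- The class `DH ∩ co-DH`. -/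
def IsDHCoDH {V : Type*} (G : SimpleGraph V) : Prop :=
  IsDistanceHereditary G ∧ IsDistanceHereditary Gᶜ

/-- The Bull: the triangle `0, 1, 2` with a pendant vertex `3` attached to `0`
and a pendant vertex `4` attached to `1`. -/
def bull : SimpleGraph (Fin 5) :=
  SimpleGraph.fromEdgeSet {s(0, 1), s(1, 2), s(0, 2), s(0, 3), s(1, 4)}

/-- Two distinct vertices are twins (true or false) if they have the same neighbours
outside of the pair. -/
def IsTwins {V : Type*} (G : SimpleGraph V) (u v : V) : Prop :=
  u ≠ v ∧ G.neighborSet u \ {u, v} = G.neighborSet v \ {u, v}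

/-- One twin elimination inside `G`, described on vertex sets of induced subgraphs: a vertex `u`
having a twin in the current induced subgraph `G[S]` is deleted. -/
def TwinElimination {V : Type*} (G : SimpleGraph V) (S T : Set V) : Prop :=
  ∃ u v : S, IsTwins (G.induce S) u v ∧ T = S \ {(u : V)}

/-- Some (possibly empty) sequence of twin eliminations leads from `G` to a graph that is
isomorphic to an induced subgraph of `H`. -/
def ReducesByTwinsToInducedSubgraphOf {V W : Type*} (G : SimpleGraph V) (H : SimpleGraph W) :
    Prop :=
  ∃ S : Set V, Relation.ReflTransGen (TwinElimination G) Set.univ S ∧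
    (G.induce S).IsIndContained H

/-- A module: every outside vertex is adjacent to all or to none of the vertices of `M`. -/
def IsModule {V : Type*} (G : SimpleGraph V) (M : Set V) : Prop :=
  ∀ v, v ∉ M → G.neighborSet v ∩ M = M ∨ G.neighborSet v ∩ M = ∅

/-- A strong module: a nonempty module that overlaps no other module. -/
def IsStrongModule {V : Type*} (G : SimpleGraph V) (M : Set V) : Prop :=
  M.Nonempty ∧ IsModule G M ∧
    ∀ M' : Set V, IsModule G M' → M ∩ M' = ∅ ∨ M ⊆ M' ∨ M' ⊆ M

/-- The nodes of the modular decomposition tree are the strong modules, ordered by inclusion;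
`s` is a child of `t` when `s ⋖ t`, the root is the top node, the leaves are the minimal nodes. -/
abbrev ModularNode {V : Type*} (G : SimpleGraph V) : Type _ :=
  {M : Set V // IsStrongModule G M}

/-- The children of a node. -/
abbrev ModularNode.Child {V : Type*} {G : SimpleGraph V} (t : ModularNode G) : Type _ :=
  {s : ModularNode G // s ⋖ t}

/-- The root of the modular decomposition tree, the module of all vertices. -/
def ModularNode.IsRoot {V : Type*} {G : SimpleGraph V} (t : ModularNode G) : Prop :=
  (t : Set V) = Set.univ

/-- An internal node is a node that has a child. -/
def ModularNode.IsInternal {V : Type*} {G : SimpleGraph V} (t : ModularNode G) : Prop :=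
  Nonempty t.Child

/-- The label of a node: the quotient graph on its children. Two distinct children are adjacent
if their vertices are adjacent in `G`
(one pair or all pairs: see `ModularNode.label_adj_iff_exists`). -/
def ModularNode.label {V : Type*} {G : SimpleGraph V} (t : ModularNode G) :
    SimpleGraph t.Child where
  Adj a b := a ≠ b ∧ ∀ u ∈ (a.1 : Set V), ∀ v ∈ (b.1 : Set V), G.Adj u v
  symm := ⟨fun _ _ h => ⟨h.1.symm, fun u hu v hv => (h.2 v hv u hu).symm⟩⟩
  loopless := ⟨fun _ h => h.1 rfl⟩

/-- Distinct children of a node are disjoint. -/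
theorem ModularNode.child_disjoint {V : Type*} {G : SimpleGraph V} {t : ModularNode G}
    (a b : t.Child) (hab : a ≠ b) : (a.1 : Set V) ∩ (b.1 : Set V) = ∅ := by
  rcases a.1.2.2.2 b.1 b.1.2.2.1 with h | h | h
  · exact h
  · rcases (show a.1 ≤ b.1 from h).lt_or_eq with h' | h'
    · exact absurd b.2.lt (a.2.2 h')
    · exact absurd (Subtype.ext h') hab
  · rcases (show b.1 ≤ a.1 from h).lt_or_eq with h' | h'
    · exact absurd a.2.lt (b.2.2 h')
    · exact absurd (Subtype.ext h'.symm) hab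

/-- The label is well defined: one adjacent pair suffices. -/
theorem ModularNode.label_adj_iff_exists {V : Type*} {G : SimpleGraph V} (t : ModularNode G)
    (a b : t.Child) : t.label.Adj a b ↔
      a ≠ b ∧ ∃ u ∈ (a.1 : Set V), ∃ v ∈ (b.1 : Set V), G.Adj u v := by
  have key : ∀ M : Set V, IsModule G M → ∀ w, w ∉ M → ∀ x ∈ M, ∀ y ∈ M,
      G.Adj w x → G.Adj w y := by
    intro M hM w hw x hx y hy hwx
    rcases hM w hw with h | h
    · have : y ∈ G.neighborSet w ∩ M := h.symm.subset hy
      exact this.1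
    · have : x ∈ G.neighborSet w ∩ M := ⟨hwx, hx⟩
      rw [h] at this
      exact this.elim
  constructor
  · rintro ⟨hne, h⟩
    obtain ⟨u, hu⟩ := a.1.2.1
    obtain ⟨v, hv⟩ := b.1.2.1
    exact ⟨hne, u, hu, v, hv, h u hu v hv⟩
  · rintro ⟨hne, u, hu, v, hv, h⟩
    refine ⟨hne, fun u' hu' v' hv' => ?_⟩
    have hd := ModularNode.child_disjoint a b hne
    have ha : ∀ x ∈ (b.1 : Set V), x ∉ (a.1 : Set V) := fun x hx hx' => by
      have : x ∈ (a.1 : Set V) ∩ (b.1 : Set V) := ⟨hx', hx⟩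
      rw [hd] at this
      exact this
    have hb : ∀ x ∈ (a.1 : Set V), x ∉ (b.1 : Set V) := fun x hx hx' => ha x hx' hx
    have h1 : G.Adj u v' := key _ b.1.2.2.1 u (hb u hu) v hv v' hv' h
    exact (key _ a.1.2.2.1 v' (ha v' hv') u hu u' hu' h1.symm).symm

/-- The tree of a nonempty graph has a root. -/
theorem ModularNode.exists_isRoot {V : Type*} [Nonempty V] (G : SimpleGraph V) :
    ∃ t : ModularNode G, t.IsRoot :=
  ⟨⟨Set.univ, Set.univ_nonempty, fun v hv => absurd (Set.mem_univ v) hv,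
    fun M' _ => Or.inr (Or.inr (Set.subset_univ M'))⟩, rfl⟩

/-- Complete or edgeless. -/
def IsCliqueOrIndependent {W : Type*} (H : SimpleGraph W) : Prop :=
  H = ⊤ ∨ H = ⊥

end DHCoDH

namespace DHCoDH

/-! ### Reduction to a local condition on induced `P₄`s -/

open SimpleGraph

variable {V : Type*} {G : SimpleGraph V}

/-! Everything goes through `P4Good`. A common neighbour of the ends of an induced `P₄` shortens a
distance, so distance-heredity forbids it. The complement of `a b c d` is the path `b d a c`, so
co-distance-heredity says that every vertex sees `b` or `c`. Conversely these two conditions bound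
induced paths by three edges and preserve distances (`isDHCoDH_iff_p4Good`).

Fix an induced `P₄`. The adjacencies to it sort all vertices into five classes, and between classes
`G` looks like the Bull (`P4Good.isQuotientMap_p4Class`). The classes are modules, and a module
meeting two of them is the whole vertex set (`IsModule.eq_univ_of_p4Class_ne`). Proper modules are
`P₄`-free, so by Seinsche's theorem a proper module with two vertices splits in `G` or in `Gᶜ`.

For (1), recursive splitting produces twins, so a twin-free graph has at most one vertex per class
and embeds in the Bull; conversely, adding a twin preserves `P4Good`. For (2), if there is a `P₄`,
the children of the root are the nonempty classes; a node that splits in `G` or `Gᶜ` has an edgeless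
or complete label (`IsSplit.not_adj`). Conversely, a `P₄` shows up in the label of the least node
containing it, which must then be the root. -/

/-- The vertices `a, b, c, d` induce a path in this order. -/
structure IsInducedP4 (G : SimpleGraph V) (a b c d : V) : Prop where
  ab : G.Adj a b
  bc : G.Adj b c
  cd : G.Adj c d
  nac : ¬ G.Adj a c
  nad : ¬ G.Adj a d
  nbd : ¬ G.Adj b d

/-- Every vertex sees a midpoint of every induced `P₄`, and misses one of its ends: this says that
no extension of a `P₄` by a vertex is `C₅`, `P₅`, a house, a gem or a co-gem. -/
def P4Good (G : SimpleGraph V) : Prop :=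
  ∀ a b c d, IsInducedP4 G a b c d → ∀ x, (G.Adj x b ∨ G.Adj x c) ∧ ¬ (G.Adj x a ∧ G.Adj x d)

theorem IsInducedP4.reverse {a b c d : V} (h : IsInducedP4 G a b c d) :
    IsInducedP4 G d c b a :=
  ⟨h.cd.symm, h.bc.symm, h.ab.symm, fun e => h.nbd e.symm, fun e => h.nad e.symm,
    fun e => h.nac e.symm⟩

theorem IsInducedP4.ne_ac {a b c d : V} (h : IsInducedP4 G a b c d) : a ≠ c := by
  rintro rfl; exact h.nad h.cd

theorem IsInducedP4.ne_ad {a b c d : V} (h : IsInducedP4 G a b c d) : a ≠ d := by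
  rintro rfl; exact h.nac h.cd.symm

theorem IsInducedP4.ne_bd {a b c d : V} (h : IsInducedP4 G a b c d) : b ≠ d := by
  rintro rfl; exact h.nad h.ab

theorem IsInducedP4.compl {a b c d : V} (h : IsInducedP4 G a b c d) :
    IsInducedP4 Gᶜ b d a c := by
  have h1 := h.ne_ac
  have h2 := h.ne_ad
  have h3 := h.ne_bd
  refine ⟨?_, ?_, ?_, ?_, ?_, ?_⟩
  · exact (compl_adj ..).2 ⟨h3, h.nbd⟩
  · exact (compl_adj ..).2 ⟨h2.symm, fun e => h.nad e.symm⟩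
  · exact (compl_adj ..).2 ⟨h1, h.nac⟩
  · exact fun e => ((compl_adj ..).1 e).2 h.ab.symm
  · exact fun e => ((compl_adj ..).1 e).2 h.bc
  · exact fun e => ((compl_adj ..).1 e).2 h.cd.symm

/-- Complementing a `P₄` exchanges its midpoints and its ends, so the two clauses trade places. -/
theorem P4Good.compl (hG : P4Good G) : P4Good Gᶜ := by
  intro a b c d h x
  have h' : IsInducedP4 G b d a c := by simpa using h.compl
  obtain ⟨h1, h2⟩ := hG _ _ _ _ h' x
  have hbc := h.bc
  constructor
  · simp only [compl_adj] at hbc ⊢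
    by_cases hb : x = b
    · subst hb; exact Or.inr hbc
    by_cases hc : x = c
    · subst hc; exact Or.inl ⟨hb, fun e => hbc.2 e.symm⟩
    by_cases hx : G.Adj x b
    · exact Or.inr ⟨hc, fun e => h2 ⟨hx, e⟩⟩
    · exact Or.inl ⟨hb, hx⟩
  · simp only [compl_adj]
    tauto

theorem P4Good.comap {W : Type*} {H : SimpleGraph W} (hG : P4Good G) (f : H ↪g G) :
    P4Good H := by
  intro a b c d h x
  have := hG (f a) (f b) (f c) (f d)
    ⟨f.map_adj_iff.2 h.ab, f.map_adj_iff.2 h.bc, f.map_adj_iff.2 h.cd,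
      fun e => h.nac (f.map_adj_iff.1 e), fun e => h.nad (f.map_adj_iff.1 e),
      fun e => h.nbd (f.map_adj_iff.1 e)⟩ (f x)
  simpa only [f.map_adj_iff] using this

theorem IsDistanceHereditary.not_adj_ends (hG : IsDistanceHereditary G) {a b c d : V}
    (h : IsInducedP4 G a b c d) (x : V) : ¬ (G.Adj x a ∧ G.Adj x d) := by
  rintro ⟨hxa, hxd⟩
  let S : Set V := {a, b, c, d}
  have ha : a ∈ S := by simp [S]
  have hb : b ∈ S := by simp [S]
  have hc : c ∈ S := by simp [S]
  have hd : d ∈ S := by simp [S]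
  have rb : (G.induce S).Reachable ⟨a, ha⟩ ⟨b, hb⟩ := Adj.reachable (by simpa using h.ab)
  have rc : (G.induce S).Reachable ⟨a, ha⟩ ⟨c, hc⟩ :=
    rb.trans (Adj.reachable (by simpa using h.bc))
  have rd : (G.induce S).Reachable ⟨a, ha⟩ ⟨d, hd⟩ :=
    rc.trans (Adj.reachable (by simpa using h.cd))
  have hr : ∀ y : S, (G.induce S).Reachable ⟨a, ha⟩ y := by
    rintro ⟨y, rfl | rfl | rfl | rfl⟩
    exacts [Reachable.refl _, rb, rc, rd]
  have hconn : (G.induce S).Connected :=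
    { preconnected := fun u v => (hr u).symm.trans (hr v), nonempty := ⟨⟨a, ha⟩⟩ }
  have hdist := hG S hconn ⟨a, ha⟩ ⟨d, hd⟩
  have h2 : G.dist a d ≤ 2 := dist_le (Walk.cons hxa.symm (Walk.cons hxd Walk.nil))
  obtain ⟨p, hp⟩ := rd.exists_walk_length_eq_dist
  rw [← hp] at hdist
  simp only at hdist
  rw [← hdist] at h2
  -- With a variable endpoint, a walk of length at most two can be analysed by cases.
  generalize hd' : (⟨d, hd⟩ : S) = d' at p
  match p, h2 with
  | .nil, _ => exact h.ne_ad (congrArg Subtype.val hd').symm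
  | .cons e .nil, _ => subst hd'; exact h.nad e
  | .cons (v := y) e (.cons e' .nil), _ =>
    subst hd'
    obtain ⟨y, rfl | rfl | rfl | rfl⟩ := y
    · exact G.irrefl e
    · exact h.nbd e'
    · exact h.nac e
    · exact h.nad e
  | .cons e (.cons e' (.cons e'' p)), h2 => simp at h2

theorem IsDHCoDH.p4Good (hG : IsDHCoDH G) : P4Good G := by
  intro a b c d h x
  refine ⟨?_, hG.1.not_adj_ends h x⟩
  have h1 := hG.2.not_adj_ends h.compl x
  have hbc := h.bc
  simp only [compl_adj] at h1
  by_cases hb : x = b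
  · subst hb; exact Or.inr hbc
  by_cases hc : x = c
  · subst hc; exact Or.inl hbc.symm
  tauto

/-- In a graph with `P4Good`, reachable vertices are joined by an induced path of length at most
three. -/
theorem P4Good.induced_path_of_reachable (hG : P4Good G) {u v : V} (h : G.Reachable u v) :
    u = v ∨ G.Adj u v ∨ (∃ b, G.Adj u b ∧ G.Adj b v) ∨ ∃ b c, IsInducedP4 G u b c v := by
  -- The walk is reversed so that induction moves the far end and keeps `u` fixed.
  obtain ⟨p⟩ := h.symm
  induction p with
  | nil => exact Or.inl rfl
  | @cons w v u e p ih =>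
    replace e := e.symm
    by_cases huw : u = w
    · exact Or.inl huw
    by_cases hadj : G.Adj u w
    · exact Or.inr (Or.inl hadj)
    right; right
    rcases ih ⟨p.reverse⟩ with rfl | h | ⟨b, hub, hbv⟩ | ⟨b, c, h⟩
    · exact absurd e hadj
    · exact Or.inl ⟨v, h, e⟩
    · by_cases huv : G.Adj u v
      · exact Or.inl ⟨v, huv, e⟩
      by_cases hbw : G.Adj b w
      · exact Or.inl ⟨b, hub, hbw⟩
      exact Or.inr ⟨b, v, hub, hbv, e, huv, hadj, hbw⟩
    · by_cases hbw : G.Adj b w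
      · exact Or.inl ⟨b, h.ab, hbw⟩
      -- This is what keeps the path from growing to four edges: `w` must see a midpoint of `u b c
      -- v`.
      have hcw : G.Adj c w := by
        rcases (hG _ _ _ _ h w).1 with h' | h'
        · exact absurd h'.symm hbw
        · exact h'.symm
      exact Or.inr ⟨b, c, h.ab, h.bc, hcw, h.nac, hadj, hbw⟩

/-- A short induced path bounds the distance in the subgraph. If it has three edges, `G` offers no
shortcut, since the ends of a `P₄` have no common neighbour. -/
theorem P4Good.isDistanceHereditary (hG : P4Good G) : IsDistanceHereditary G := by
  intro S hS u v
  have hr := hS.preconnected u v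
  have hr' : G.Reachable (u : V) v := hr.map (Embedding.induce S).toHom
  apply le_antisymm
  · obtain ⟨p, hp⟩ := hr'.exists_walk_length_eq_dist
    rw [← hp]
    rcases (hG.comap (Embedding.induce S)).induced_path_of_reachable hr with
      rfl | h | ⟨b, hub, hbv⟩ | ⟨b, c, h⟩
    · simp
    · have h1 : (G.induce S).dist u v ≤ 1 := dist_le (.cons h .nil)
      refine h1.trans ?_
      have : p.length ≠ 0 := fun h0 => h.ne (Subtype.ext (Walk.eq_of_length_eq_zero h0))
      omega
    · have h1 : (G.induce S).dist u v ≤ 2 := dist_le (.cons hub (.cons hbv .nil))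
      by_cases huv : u = v
      · subst huv; simp
      by_cases hadj : (G.induce S).Adj u v
      · have h1 : (G.induce S).dist u v ≤ 1 := dist_le (.cons hadj .nil)
        refine h1.trans ?_
        have : p.length ≠ 0 := fun h0 => huv (Subtype.ext (Walk.eq_of_length_eq_zero h0))
        omega
      · have h0 : p.length ≠ 0 := fun h0 => huv (Subtype.ext (Walk.eq_of_length_eq_zero h0))
        have h0' : p.length ≠ 1 := fun h0 => 
          hadj (show G.Adj (u : V) v from Walk.adj_of_length_eq_one h0)
        omega
    · have h1 : (G.induce S).dist u v ≤ 3 :=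
        dist_le (.cons h.ab (.cons h.bc (.cons h.cd .nil)))
      have h' : IsInducedP4 G (u : V) b c v := ⟨h.ab, h.bc, h.cd, h.nac, h.nad, h.nbd⟩
      refine h1.trans ?_
      generalize (u : V) = u' at *
      generalize (v : V) = v' at *
      match p with
      | .nil => exact absurd rfl h'.ne_ad
      | .cons e .nil => exact absurd e h'.nad
      | .cons (v := y) e (.cons e' .nil) => exact absurd ⟨e.symm, e'⟩ (hG _ _ _ _ h' y).2
      | .cons _ (.cons _ (.cons _ p)) => simp
  · obtain ⟨p, hp⟩ := hr.exists_walk_length_eq_dist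
    rw [← hp, ← Walk.length_map (Embedding.induce S).toHom p]
    exact dist_le _

theorem isDHCoDH_iff_p4Good : IsDHCoDH G ↔ P4Good G :=
  ⟨IsDHCoDH.p4Good, fun h => ⟨h.isDistanceHereditary, h.compl.isDistanceHereditary⟩⟩

theorem bull_adj_iff (i j : Fin 5) : bull.Adj i j ↔
    (i, j) ∈ ([(0, 1), (1, 0), (1, 2), (2, 1), (0, 2), (2, 0), (0, 3), (3, 0), (1, 4), (4, 1)] :
      List (Fin 5 × Fin 5)) := by
  simp only [bull, fromEdgeSet_adj, Set.mem_insert_iff, Set.mem_singleton_iff]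
  revert i j
  decide

instance : DecidableRel bull.Adj := fun i j => decidable_of_iff _ (bull_adj_iff i j).symm

theorem bull_p4Good : P4Good bull := by
  intro a b c d h
  obtain ⟨h1, h2, h3, h4, h5, h6⟩ := h
  revert a b c d
  decide

/-! ### The five classes around an induced `P₄` -/

section Classes

variable {a b c d : V}

open Classical in
/-- The vertex of the bull whose position relative to the path `a, b, c, d` is that of `x`. -/
noncomputable def p4Class (G : SimpleGraph V) (a b c d x : V) : Fin 5 :=
  if G.Adj x a ∧ G.Adj x c then 0 else if G.Adj x d ∧ G.Adj x b then 1
  else if G.Adj x b ∧ G.Adj x c then 2 else if G.Adj x b then 3 else 4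

/-- The graph `H` describes the adjacency in `G` between vertices of different classes. -/
def IsQuotientMap {W : Type*} (G : SimpleGraph V) (H : SimpleGraph W) (f : V → W) : Prop :=
  ∀ u v, f u ≠ f v → (G.Adj u v ↔ H.Adj (f u) (f v))

/-- The relation that membership in the `i`-th class amounts to. -/
def InP4Class (G : SimpleGraph V) (a b c d x : V) (i : Fin 5) : Prop :=
  match i with
  | 0 => G.Adj x a ∧ G.Adj x c ∧ ¬ G.Adj x d
  | 1 => G.Adj x d ∧ G.Adj x b ∧ ¬ G.Adj x a
  | 2 => G.Adj x b ∧ G.Adj x c ∧ ¬ G.Adj x a ∧ ¬ G.Adj x d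
  | 3 => G.Adj x b ∧ ¬ G.Adj x c ∧ ¬ G.Adj x d
  | 4 => G.Adj x c ∧ ¬ G.Adj x b ∧ ¬ G.Adj x a

/-- `P4Good` leaves nine adjacency patterns to the path. The vertices `b, c, a, d` lie in classes 0,
1, 3, 4, and each of these classes leaves open the adjacency to its own path vertex. -/
theorem inP4Class_p4Class (hG : P4Good G) (h : IsInducedP4 G a b c d) (x : V) :
    InP4Class G a b c d x (p4Class G a b c d x) := by
  have := hG _ _ _ _ h x
  unfold p4Class InP4Class
  split_ifs <;> simp only <;> tauto

variable {p q : V}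

/-- Reversing the path swaps 0 with 1 and 3 with 4 and fixes 2, which roughly halves the case
analysis. -/
theorem InP4Class.reverse0 (hp : InP4Class G a b c d p 0) : InP4Class G d c b a p 1 := hp

theorem InP4Class.reverse1 (hp : InP4Class G a b c d p 1) : InP4Class G d c b a p 0 := hp

theorem InP4Class.reverse2 (hp : InP4Class G a b c d p 2) : InP4Class G d c b a p 2 :=
  ⟨hp.2.1, hp.1, hp.2.2.2, hp.2.2.1⟩

theorem InP4Class.reverse4 (hp : InP4Class G a b c d p 4) : InP4Class G d c b a p 3 := hp

/-- The method for all pairs of classes: substitute class members into the path and apply `P4Good`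
to the new `P₄`. -/
theorem P4Good.adj_end_mid (hG : P4Good G) (h : IsInducedP4 G a b c d)
    (hp : InP4Class G a b c d p 3) (hq : InP4Class G a b c d q 0) : G.Adj p q := by
  simp only [InP4Class] at hp hq
  have h' : IsInducedP4 G a q c d := ⟨hq.1.symm, hq.2.1, h.cd, h.nac, h.nad, hq.2.2⟩
  exact ((hG _ _ _ _ h' p).1).resolve_right hp.2.1

theorem P4Good.not_adj_end_mid (hG : P4Good G) (h : IsInducedP4 G a b c d)
    (hp : InP4Class G a b c d p 3) (hq : InP4Class G a b c d q 1) : ¬ G.Adj p q := by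
  simp only [InP4Class] at hp hq
  have h' : IsInducedP4 G p b c d := ⟨hp.1, h.bc, h.cd, hp.2.1, hp.2.2, h.nbd⟩
  exact fun e => (hG _ _ _ _ h' q).2 ⟨e.symm, hq.1⟩

/-- Given an edge `pq`, the path `a b c q` forbids `p` to see `a`. Then `a b p q` is induced, yet
`d` sees neither of its midpoints. -/
theorem P4Good.not_adj_end_end (hG : P4Good G) (h : IsInducedP4 G a b c d)
    (hp : InP4Class G a b c d p 3) (hq : InP4Class G a b c d q 4) : ¬ G.Adj p q := by
  simp only [InP4Class] at hp hq
  intro e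
  have h1 : IsInducedP4 G a b c q :=
    ⟨h.ab, h.bc, hq.1.symm, h.nac, fun e => hq.2.2 e.symm, fun e => hq.2.1 e.symm⟩
  have hpa := fun e' => (hG _ _ _ _ h1 p).2 ⟨e', e⟩
  have h2 : IsInducedP4 G p b c d := ⟨hp.1, h.bc, h.cd, hp.2.1, hp.2.2, h.nbd⟩
  have hqd := fun e' => (hG _ _ _ _ h2 q).2 ⟨e.symm, e'⟩
  have h3 : IsInducedP4 G a b p q :=
    ⟨h.ab, hp.1.symm, e, fun e => hpa e.symm, fun e => hq.2.2 e.symm, fun e => hq.2.1 e.symm⟩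
  rcases (hG _ _ _ _ h3 d).1 with e | e
  · exact h.nbd e.symm
  · exact hp.2.2 e.symm

theorem P4Good.not_adj_end_top (hG : P4Good G) (h : IsInducedP4 G a b c d)
    (hp : InP4Class G a b c d p 3) (hq : InP4Class G a b c d q 2) : ¬ G.Adj p q := by
  simp only [InP4Class] at hp hq
  intro e
  have h1 : IsInducedP4 G p q c d := ⟨e, hq.2.1, h.cd, hp.2.1, hp.2.2, hq.2.2.2⟩
  rcases (hG _ _ _ _ h1 a).1 with e | e
  · exact hq.2.2.1 e.symm
  · exact h.nac e

/-- If `p` and `q` were not adjacent, `a p c d` would force `q` to see `c`; then `a p c q` is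
induced and `b` sees both its ends. -/
theorem P4Good.adj_mid_mid (hG : P4Good G) (h : IsInducedP4 G a b c d)
    (hp : InP4Class G a b c d p 0) (hq : InP4Class G a b c d q 1) : G.Adj p q := by
  simp only [InP4Class] at hp hq
  by_contra e
  have h1 : IsInducedP4 G a p c d := ⟨hp.1.symm, hp.2.1, h.cd, h.nac, h.nad, hp.2.2⟩
  have h2 : IsInducedP4 G a b q d :=
    ⟨h.ab, hq.2.1.symm, hq.1, fun e => hq.2.2 e.symm, h.nad, h.nbd⟩
  have hqc := ((hG _ _ _ _ h1 q).1).resolve_left fun e' => e e'.symm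
  have hpb := ((hG _ _ _ _ h2 p).1).resolve_right e
  have h3 : IsInducedP4 G a p c q :=
    ⟨hp.1.symm, hp.2.1, hqc.symm, h.nac, fun e => hq.2.2 e.symm, e⟩
  exact (hG _ _ _ _ h3 b).2 ⟨h.ab.symm, hq.2.1.symm⟩

theorem P4Good.adj_mid_top (hG : P4Good G) (h : IsInducedP4 G a b c d)
    (hp : InP4Class G a b c d p 0) (hq : InP4Class G a b c d q 2) : G.Adj p q := by
  simp only [InP4Class] at hp hq
  by_contra e
  have h1 : IsInducedP4 G a p c q :=
    ⟨hp.1.symm, hp.2.1, hq.2.1.symm, h.nac, fun e => hq.2.2.1 e.symm, e⟩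
  exact (hG _ _ _ _ h1 b).2 ⟨h.ab.symm, hq.1.symm⟩

theorem P4Good.adj_iff_of_lt (hG : P4Good G) (h : IsInducedP4 G a b c d) {i j : Fin 5}
    (hp : InP4Class G a b c d p i) (hq : InP4Class G a b c d q j) (hij : i < j) :
    G.Adj p q ↔ bull.Adj i j := by
  have hr := h.reverse
  fin_cases i <;> fin_cases j <;> simp at hij
  · exact iff_of_true (hG.adj_mid_mid h hp hq) (by decide)
  · exact iff_of_true (hG.adj_mid_top h hp hq) (by decide)
  · exact iff_of_true (hG.adj_end_mid h hq hp).symm (by decide)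
  · exact iff_of_false (fun e => hG.not_adj_end_mid hr hq.reverse4 hp.reverse0 e.symm) (by decide)
  · exact iff_of_true (hG.adj_mid_top hr hp.reverse1 hq.reverse2) (by decide)
  · exact iff_of_false (fun e => hG.not_adj_end_mid h hq hp e.symm) (by decide)
  · exact iff_of_true (hG.adj_end_mid hr hq.reverse4 hp.reverse1).symm (by decide)
  · exact iff_of_false (fun e => hG.not_adj_end_top h hq hp e.symm) (by decide)
  · exact iff_of_false (fun e => hG.not_adj_end_top hr hq.reverse4 hp.reverse2 e.symm) (by decide)
  · exact iff_of_false (hG.not_adj_end_end h hp hq) (by decide)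

theorem P4Good.isQuotientMap_p4Class (hG : P4Good G) (h : IsInducedP4 G a b c d) :
    IsQuotientMap G bull (p4Class G a b c d) := by
  intro u v huv
  have hu := inP4Class_p4Class hG h u
  have hv := inP4Class_p4Class hG h v
  rcases lt_or_gt_of_ne huv with hlt | hlt
  · exact hG.adj_iff_of_lt h hu hv hlt
  · rw [G.adj_comm, bull.adj_comm]
    exact hG.adj_iff_of_lt h hv hu hlt

end Classes

/-! ### Modules in the presence of an induced `P₄` -/

section Modules

/-- A module does not distinguish its vertices from outside. -/
theorem isModule_iff {M : Set V} : IsModule G M ↔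
    ∀ w, w ∉ M → ∀ x ∈ M, ∀ y ∈ M, G.Adj w x → G.Adj w y := by
  constructor
  · intro hM w hw x hx y hy hwx
    rcases hM w hw with h | h
    · exact (h.symm.subset hy).1
    · exact absurd (h.subset ⟨hwx, hx⟩) (Set.notMem_empty x)
  · intro hM w hw
    by_cases h : ∃ x ∈ M, G.Adj w x
    · obtain ⟨x, hx, hwx⟩ := h
      exact Or.inl (Set.inter_eq_right.2 fun y hy => hM w hw x hx y hy hwx)
    · push Not at h
      exact Or.inr (Set.eq_empty_of_forall_notMem fun x hx => h x hx.2 hx.1)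

theorem IsModule.adj_iff {M : Set V} (hM : IsModule G M) {w x y : V} (hw : w ∉ M) (hx : x ∈ M)
    (hy : y ∈ M) : G.Adj w x ↔ G.Adj w y :=
  ⟨isModule_iff.1 hM w hw x hx y hy, isModule_iff.1 hM w hw y hy x hx⟩

theorem IsModule.mem_of_adj {M : Set V} (hM : IsModule G M) {w x y : V} (hx : x ∈ M)
    (hy : y ∈ M) (h : G.Adj w x) (h' : ¬ G.Adj w y) : w ∈ M := by
  by_contra hw
  exact h' ((hM.adj_iff hw hx hy).1 h)

theorem IsModule.compl {M : Set V} (hM : IsModule G M) : IsModule Gᶜ M := by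
  refine isModule_iff.2 fun w hw x hx y hy h => ?_
  rw [compl_adj] at h ⊢
  exact ⟨fun e => hw (e ▸ hy), fun e => h.2 ((hM.adj_iff hw hx hy).2 e)⟩

theorem isModule_compl_iff {M : Set V} : IsModule Gᶜ M ↔ IsModule G M :=
  ⟨fun h => by simpa using h.compl, IsModule.compl⟩

theorem isStrongModule_compl_iff {M : Set V} : IsStrongModule Gᶜ M ↔ IsStrongModule G M := by
  simp only [IsStrongModule, isModule_compl_iff]

theorem isModule_univ : IsModule G Set.univ := fun v hv => absurd (Set.mem_univ v) hv

theorem isModule_singleton (v : V) : IsModule G {v} := by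
  refine isModule_iff.2 fun w _ x hx y hy h => ?_
  rw [Set.mem_singleton_iff] at hx hy
  rwa [hy, ← hx]

theorem IsQuotientMap.isModule_fiber {W : Type*} {H : SimpleGraph W} {f : V → W}
    (hf : IsQuotientMap G H f) (i : W) : IsModule G {x | f x = i} := by
  refine isModule_iff.2 fun w hw x hx y hy h => ?_
  simp only [Set.mem_ofPred_eq] at hw hx hy
  rw [hf w x (by rwa [hx])] at h
  rw [hf w y (by rwa [hy]), hy, ← hx]
  exact h

variable {a b c d : V}

/-- A module containing two vertices of an induced `P₄` contains all four. -/
theorem IsModule.mem_of_two_mem {M : Set V} (hM : IsModule G M) (h : IsInducedP4 G a b c d)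
    {x y : V} (hx : x ∈ ({a, b, c, d} : Set V)) (hy : y ∈ ({a, b, c, d} : Set V)) (hxy : x ≠ y)
    (hxM : x ∈ M) (hyM : y ∈ M) : a ∈ M ∧ b ∈ M ∧ c ∈ M ∧ d ∈ M := by
  have key : ∀ {w x y}, x ∈ M → y ∈ M → G.Adj w x → ¬ G.Adj w y → w ∈ M := hM.mem_of_adj
  obtain ⟨h1, h2, h3, h4, h5, h6⟩ := h
  have h1' := h1.symm
  have h2' := h2.symm
  have h3' := h3.symm
  rw [G.adj_comm] at h4 h5 h6
  have h4' := fun e => h4 (G.adj_symm e)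
  have h5' := fun e => h5 (G.adj_symm e)
  have h6' := fun e => h6 (G.adj_symm e)
  -- Each pair of path vertices is distinguished by a third, which must then lie in `M`; iterating
  -- reaches all four.
  have ab : a ∈ M → b ∈ M → c ∈ M := fun p q => key q p h2' h4
  have ac : a ∈ M → c ∈ M → d ∈ M := fun p q => key q p h3' h5
  have ad : a ∈ M → d ∈ M → b ∈ M := fun p q => key p q h1' h6'
  have bc : b ∈ M → c ∈ M → a ∈ M := fun p q => key p q h1 h4'
  have bd : b ∈ M → d ∈ M → a ∈ M := fun p q => key p q h1 h5'
  have cd : c ∈ M → d ∈ M → b ∈ M := fun p q => key p q h2 h6'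
  clear key h1 h2 h3 h4 h5 h6 h1' h2' h3' h4' h5' h6'
  rcases hx with rfl | rfl | rfl | rfl <;> rcases hy with rfl | rfl | rfl | rfl <;> grind

/-- An outside vertex would see all four path vertices, hence both ends, or none, hence no midpoint.
-/
theorem IsModule.eq_univ_of_p4 {M : Set V} (hM : IsModule G M) (hG : P4Good G)
    (h : IsInducedP4 G a b c d) (hS : a ∈ M ∧ b ∈ M ∧ c ∈ M ∧ d ∈ M) : M = Set.univ := by
  refine Set.eq_univ_of_forall fun x => by_contra fun hx => ?_
  obtain ⟨ha, hb, hc, hd⟩ := hS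
  obtain ⟨h1, h2⟩ := hG _ _ _ _ h x
  have e1 := hM.adj_iff hx ha hb
  have e2 := hM.adj_iff hx ha hc
  have e3 := hM.adj_iff hx ha hd
  tauto

/-- A module that meets two classes is everything. -/
theorem IsModule.eq_univ_of_p4Class_ne {M : Set V} (hM : IsModule G M) (hG : P4Good G)
    (h : IsInducedP4 G a b c d) {x y : V} (hx : x ∈ M) (hy : y ∈ M)
    (hxy : p4Class G a b c d x ≠ p4Class G a b c d y) : M = Set.univ := by
  -- Two vertices of different classes, neither in class 2, can be substituted into one common
  -- induced `P₄`, which `M` then contains.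
  have two : ∀ {a b c d x y : V}, IsInducedP4 G a b c d → x ∈ ({a, b, c, d} : Set V) →
      y ∈ ({a, b, c, d} : Set V) → x ≠ y → x ∈ M → y ∈ M → M = Set.univ :=
    fun h h1 h2 h3 h4 h5 => hM.eq_univ_of_p4 hG h (hM.mem_of_two_mem h h1 h2 h3 h4 h5)
  have k01 : ∀ {a b c d x y : V}, IsInducedP4 G a b c d → InP4Class G a b c d x 0 →
      InP4Class G a b c d y 1 → x ∈ M → y ∈ M → M = Set.univ := fun {a b c d x y} h hx hy =>
    have e := hG.adj_mid_mid h hx hy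
    two (a := a) (b := x) (c := y) (d := d)
      ⟨hx.1.symm, e, hy.1, fun e => hy.2.2 e.symm, h.nad, hx.2.2⟩ (by simp) (by simp) e.ne
  have k03 : ∀ {a b c d x y : V}, IsInducedP4 G a b c d → InP4Class G a b c d x 0 →
      InP4Class G a b c d y 3 → x ∈ M → y ∈ M → M = Set.univ := fun {a b c d x y} h hx hy =>
    have e := hG.adj_end_mid h hy hx
    two (a := y) (b := x) (c := c) (d := d)
      ⟨e, hx.2.1, h.cd, hy.2.1, hy.2.2, hx.2.2⟩ (by simp) (by simp) e.ne.symm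
  have k13 : ∀ {a b c d x y : V}, IsInducedP4 G a b c d → InP4Class G a b c d x 1 →
      InP4Class G a b c d y 3 → x ∈ M → y ∈ M → M = Set.univ := fun {a b c d x y} h hx hy =>
    have e : IsInducedP4 G y b x d :=
      ⟨hy.1, hx.2.1.symm, hx.1, hG.not_adj_end_mid h hy hx, hy.2.2, h.nbd⟩
    two e (by simp) (by simp) e.ne_ac.symm
  have k34 : ∀ {a b c d x y : V}, IsInducedP4 G a b c d → InP4Class G a b c d x 3 →
      InP4Class G a b c d y 4 → x ∈ M → y ∈ M → M = Set.univ := fun {a b c d x y} h hx hy =>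
    have e : IsInducedP4 G x b c y :=
      ⟨hx.1, h.bc, hy.1.symm, hx.2.1, hG.not_adj_end_end h hx hy, fun e => hy.2.1 e.symm⟩
    two e (by simp) (by simp) e.ne_ad
  -- Class 2 has no place on the path, so a path vertex distinguishing `x` from `y` is first drawn
  -- into `M`.
  have k02 : ∀ {a b c d x y : V}, IsInducedP4 G a b c d → InP4Class G a b c d x 0 →
      InP4Class G a b c d y 2 → x ∈ M → y ∈ M → M = Set.univ := fun {a b c d x y} h hx hy hxM hyM =>
    have haM : a ∈ M := hM.mem_of_adj hxM hyM hx.1.symm fun e => hy.2.2.1 e.symm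
    two (a := a) (b := x) (c := c) (d := d)
      ⟨hx.1.symm, hx.2.1, h.cd, h.nac, h.nad, hx.2.2⟩ (by simp) (by simp) hx.1.ne.symm haM hxM
  have k23 : ∀ {a b c d x y : V}, IsInducedP4 G a b c d → InP4Class G a b c d x 2 →
      InP4Class G a b c d y 3 → x ∈ M → y ∈ M → M = Set.univ := fun {a b c d x y} h hx hy hxM hyM =>
    have hcM : c ∈ M := hM.mem_of_adj hxM hyM hx.2.1.symm fun e => hy.2.1 e.symm
    have e : IsInducedP4 G y b c d := ⟨hy.1, h.bc, h.cd, hy.2.1, hy.2.2, h.nbd⟩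
    two e (by simp) (by simp) e.ne_ac hyM hcM
  have hr := h.reverse
  have cx := inP4Class_p4Class hG h x
  have cy := inP4Class_p4Class hG h y
  generalize p4Class G a b c d x = i at *
  generalize p4Class G a b c d y = j at *
  wlog hij : i < j generalizing x y i j
  · exact this hy hx j cy i cx hxy.symm (lt_of_le_of_ne (not_lt.1 hij) hxy.symm)
  fin_cases i <;> fin_cases j <;> simp at hij
  · exact k01 h cx cy hx hy
  · exact k02 h cx cy hx hy
  · exact k03 h cx cy hx hy
  · exact k13 hr cx.reverse0 cy.reverse4 hx hy
  · exact k02 hr cx.reverse1 cy.reverse2 hx hy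
  · exact k13 h cx cy hx hy
  · exact k03 hr cx.reverse1 cy.reverse4 hx hy
  · exact k23 h cx cy hx hy
  · exact k23 hr cx.reverse2 cy.reverse4 hx hy
  · exact k34 h cx cy hx hy

end Modules

/-! ### `P₄`-free sets: splittings and twins -/

/-- No four vertices of `K` induce a path. -/
def IsP4Free (G : SimpleGraph V) (K : Set V) : Prop :=
  ∀ a ∈ K, ∀ b ∈ K, ∀ c ∈ K, ∀ d ∈ K, ¬ IsInducedP4 G a b c d

theorem IsP4Free.mono {K L : Set V} (hL : IsP4Free G L) (h : K ⊆ L) : IsP4Free G K :=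
  fun a ha b hb c hc d hd => hL a (h ha) b (h hb) c (h hc) d (h hd)

theorem IsP4Free.compl {K : Set V} (hK : IsP4Free G K) : IsP4Free Gᶜ K :=
  fun a ha b hb c hc d hd h => hK b hb d hd a ha c hc (by simpa using h.compl)

theorem IsModule.isP4Free {M : Set V} (hM : IsModule G M) (hG : P4Good G)
    (hne : M ≠ Set.univ) : IsP4Free G M :=
  fun _ ha _ hb _ hc _ hd h => hne (hM.eq_univ_of_p4 hG h ⟨ha, hb, hc, hd⟩)

/-- The graph induced on `K` is disconnected. -/
def IsSplit (G : SimpleGraph V) (K : Set V) : Prop :=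
  ∃ A B : Set V, A.Nonempty ∧ B.Nonempty ∧ Disjoint A B ∧ A ∪ B = K ∧
    ∀ x ∈ A, ∀ y ∈ B, ¬ G.Adj x y

theorem isSplit_compl_of_forall_adj {A B : Set V} (hA : A.Nonempty) (hB : B.Nonempty)
    (h : ∀ x ∈ A, ∀ y ∈ B, G.Adj x y) : IsSplit Gᶜ (A ∪ B) := by
  refine ⟨A, B, hA, hB, ?_, rfl, fun x hx y hy e => ((compl_adj ..).1 e).2 (h x hx y hy)⟩
  exact Set.disjoint_left.2 fun x hx hx' => G.irrefl (h x hx x hx')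

/-- If `v` sees everything, it splits off in the complement. Otherwise say `v` misses a vertex of
`A`. If it sees nothing in `B`, it joins `A`. If it sees `z ∈ B`, its non-neighbours in `A` split
off: an edge from such an `x` to a neighbour `w ∈ A` of `v` would give the path `z v w x`. -/
theorem IsP4Free.isSplit_insert {A B : Set V} {v : V} (hA : A.Nonempty) (hB : B.Nonempty)
    (hd : Disjoint A B) (hn : ∀ x ∈ A, ∀ y ∈ B, ¬ G.Adj x y) (hv : v ∉ A ∪ B)
    (hP : IsP4Free G (insert v (A ∪ B))) :
    IsSplit G (insert v (A ∪ B)) ∨ IsSplit Gᶜ (insert v (A ∪ B)) := by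
  by_cases hc : ∀ y ∈ A ∪ B, G.Adj v y
  · right
    rw [Set.insert_eq]
    refine isSplit_compl_of_forall_adj (Set.singleton_nonempty v) hA.inl ?_
    rintro x rfl y hy
    exact hc y hy
  left
  push Not at hc
  obtain ⟨y, hy, hvy⟩ := hc
  wlog hyA : y ∈ A generalizing A B
  · rw [Set.union_comm] at hv hP hy ⊢
    exact this hB hA hd.symm (fun x hx y hy e => hn y hy x hx e.symm) hv hP hy
      (hy.resolve_right hyA)
  have hvA : v ∉ A := fun h => hv (Or.inl h)
  have hvB : v ∉ B := fun h => hv (Or.inr h)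
  rw [Set.disjoint_left] at hd
  by_cases hz : ∃ z ∈ B, G.Adj v z
  · obtain ⟨z, hz, hvz⟩ := hz
    refine ⟨{x | x ∈ A ∧ ¬ G.Adj v x}, insert v ({x | x ∈ A ∧ G.Adj v x} ∪ B), ⟨y, hyA, hvy⟩,
      Set.insert_nonempty _ _, ?_, ?_, ?_⟩
    · rw [Set.disjoint_left]
      rintro x ⟨hx, hvx⟩ (rfl | ⟨_, h⟩ | h)
      exacts [hvA hx, hvx h, hd hx h]
    · ext x
      simp only [Set.mem_union, Set.mem_insert_iff, Set.mem_ofPred_eq]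
      tauto
    · rintro x ⟨hx, hvx⟩ w (rfl | ⟨hw, hvw⟩ | hw) e
      · exact hvx e.symm
      · exact hP z (by simp [hz]) v (by simp) w (by simp [hw]) x (by simp [hx])
          ⟨hvz.symm, hvw, e.symm, fun e' => hn w hw z hz e'.symm, fun e' => hn x hx z hz e'.symm,
            hvx⟩
      · exact hn x hx w hw e
  · push Not at hz
    refine ⟨insert v A, B, Set.insert_nonempty _ _, hB, ?_, Set.insert_union .., ?_⟩
    · rw [Set.disjoint_left]
      rintro x (rfl | h)
      exacts [hvB, hd h]
    · rintro x (rfl | h) w hw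
      exacts [hz w hw, hn x h w hw]

/-- Seinsche's theorem: a `P₄`-free graph with two vertices is disconnected, or its complement
is. -/
theorem IsP4Free.isSplit_or_isSplit_compl {K : Set V} (hfin : K.Finite) (hnt : K.Nontrivial)
    (hP : IsP4Free G K) : IsSplit G K ∨ IsSplit Gᶜ K := by
  induction K, hfin using Set.Finite.induction_on with
  | empty => exact absurd hnt Set.not_nontrivial_empty
  | @insert v K hv hfin ih =>
    by_cases hK : K.Nontrivial
    · rcases ih hK (hP.mono (Set.subset_insert ..)) with h | h
      · obtain ⟨A, B, hA, hB, hd, rfl, hn⟩ := h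
        exact hP.isSplit_insert hA hB hd hn hv
      · obtain ⟨A, B, hA, hB, hd, rfl, hn⟩ := h
        simpa [or_comm] using hP.compl.isSplit_insert hA hB hd hn hv
    · rw [Set.not_nontrivial_iff] at hK
      obtain ⟨w, hw⟩ : K.Nonempty := by
        rw [Set.nonempty_iff_ne_empty]
        rintro rfl
        simp at hnt
      obtain rfl := hK.eq_singleton_of_mem hw
      have hvw : v ≠ w := hv
      by_cases e : G.Adj v w
      · right
        rw [Set.insert_eq]
        exact isSplit_compl_of_forall_adj (Set.singleton_nonempty _) (Set.singleton_nonempty _)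
          (by rintro _ rfl _ rfl; exact e)
      · left
        exact ⟨{v}, {w}, Set.singleton_nonempty _, Set.singleton_nonempty _, by simpa using hvw,
          (Set.insert_eq ..).symm, by rintro _ rfl _ rfl; exact e⟩

theorem isTwins_iff {u v : V} : IsTwins G u v ↔
    u ≠ v ∧ ∀ w, w ≠ u → w ≠ v → (G.Adj u w ↔ G.Adj v w) := by
  simp only [IsTwins, Set.ext_iff, Set.mem_sdiff, mem_neighborSet, Set.mem_insert_iff,
    Set.mem_singleton_iff]
  refine and_congr_right fun _ => forall_congr' fun w => ?_
  tauto

theorem isTwins_compl_iff {u v : V} : IsTwins Gᶜ u v ↔ IsTwins G u v := by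
  simp only [isTwins_iff, compl_adj]
  refine and_congr_right fun _ => forall_congr' fun w => ?_
  have := @ne_comm _ w u
  have := @ne_comm _ w v
  tauto

theorem IsModule.subset_of_split {A B : Set V} (hM : IsModule G (A ∪ B))
    (hn : ∀ x ∈ A, ∀ y ∈ B, ¬ G.Adj x y) : IsModule G A := by
  refine isModule_iff.2 fun w hw x hx y hy h => ?_
  by_cases hwB : w ∈ B
  · exact absurd h.symm (hn x hx w hwB)
  · exact isModule_iff.1 hM w (by simp [hw, hwB]) x (Or.inl hx) y (Or.inl hy) h

/-- Both sides of a split module are again modules. Either one of them is nontrivial and smaller, or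
`K` is a two-element module, that is, a pair of twins. -/
theorem IsModule.exists_isTwins_of_isSplit {K : Set V} (hM : IsModule G K) (hK : IsSplit G K)
    (ih : ∀ L ⊂ K, IsModule G L → L.Nontrivial → ∃ u v, IsTwins G u v) :
    ∃ u v, IsTwins G u v := by
  obtain ⟨A, B, ⟨u, hu⟩, ⟨v, hv⟩, hd, rfl, hn⟩ := hK
  rw [Set.disjoint_left] at hd
  have hMA : IsModule G A := hM.subset_of_split hn
  have hMB : IsModule G B :=
    (Set.union_comm A B ▸ hM).subset_of_split fun x hx y hy e => hn y hy x hx e.symm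
  by_cases hA : A.Nontrivial
  · exact ih A ⟨Set.subset_union_left, fun h => hd (h (Or.inr hv)) hv⟩ hMA hA
  by_cases hB : B.Nontrivial
  · exact ih B ⟨Set.subset_union_right, fun h => hd hu (h (Or.inl hu))⟩ hMB hB
  rw [Set.not_nontrivial_iff] at hA hB
  obtain rfl := hA.eq_singleton_of_mem hu
  obtain rfl := hB.eq_singleton_of_mem hv
  refine ⟨u, v, isTwins_iff.2 ⟨fun e => hd hu e, fun w hwu hwv => ?_⟩⟩
  rw [G.adj_comm u, G.adj_comm v]
  exact hM.adj_iff (by simp [hwu, hwv]) (by simp) (by simp)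

/-- A graph with a `P₄`-free module with two vertices has twins. -/
theorem IsModule.exists_isTwins [Finite V] (K : Set V) (hM : IsModule G K)
    (hnt : K.Nontrivial) (hP : IsP4Free G K) : ∃ u v, IsTwins G u v := by
  induction K using WellFoundedLT.induction with
  | ind K ih =>
    have ih' : ∀ L ⊂ K, IsModule G L → L.Nontrivial → ∃ u v, IsTwins G u v :=
      fun L hL hML hnL => ih L hL hML hnL (hP.mono hL.subset)
    rcases hP.isSplit_or_isSplit_compl K.toFinite hnt with h | h
    · exact hM.exists_isTwins_of_isSplit h ih'
    · obtain ⟨u, v, huv⟩ := hM.compl.exists_isTwins_of_isSplit h fun L hL hML hnL => by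
        simpa only [isTwins_compl_iff] using ih' L hL (isModule_compl_iff.1 hML) hnL
      exact ⟨u, v, isTwins_compl_iff.1 huv⟩

/-! ### Twin-free graphs embed in the Bull -/

section Classes

variable {a b c d : V}

theorem P4Good.p4Class_mid_ne (hG : P4Good G) (h : IsInducedP4 G a b c d) :
    p4Class G a b c d b ≠ p4Class G a b c d c := by
  intro e
  have hb := inP4Class_p4Class hG h b
  have hc := inP4Class_p4Class hG h c
  rw [← e] at hc
  generalize p4Class G a b c d b = i at *
  fin_cases i
  exacts [G.irrefl hc.2.1, G.irrefl hb.2.1, G.irrefl hb.1, G.irrefl hb.1, G.irrefl hc.1]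

theorem P4Good.p4Class_fiber_ne_univ (hG : P4Good G) (h : IsInducedP4 G a b c d) (i : Fin 5) :
    {x | p4Class G a b c d x = i} ≠ Set.univ := by
  rw [Set.ne_univ_iff_exists_notMem]
  by_cases hb : p4Class G a b c d b = i
  · exact ⟨c, fun hc => hG.p4Class_mid_ne h (hb.trans (Eq.symm hc))⟩
  · exact ⟨b, hb⟩

end Classes

theorem IsQuotientMap.isIndContained {W : Type*} {H : SimpleGraph W} {f : V → W}
    (hf : IsQuotientMap G H f) (hinj : f.Injective) : G.IsIndContained H := by
  refine ⟨⟨⟨f, hinj⟩, fun {u v} => ?_⟩⟩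
  by_cases huv : u = v
  · subst huv; simp
  · exact (hf u v (hinj.ne huv)).symm

theorem P4Good.isIndContained_bull_of_no_twins [Finite V] (hG : P4Good G)
    (hno : ∀ u v, ¬ IsTwins G u v) : G.IsIndContained bull := by
  by_cases hp : ∃ a b c d, IsInducedP4 G a b c d
  · obtain ⟨a, b, c, d, h⟩ := hp
    have hf := hG.isQuotientMap_p4Class h
    refine hf.isIndContained fun x y hxy => by_contra fun hne => ?_
    have hM := hf.isModule_fiber (p4Class G a b c d y)
    obtain ⟨u, v, huv⟩ := hM.exists_isTwins _ ⟨x, hxy, y, rfl, hne⟩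
      (hM.isP4Free hG (hG.p4Class_fiber_ne_univ h _))
    exact hno u v huv
  · push Not at hp
    -- The whole graph is `P₄`-free and twin-free, so it has at most one vertex and any constant map
    -- embeds it.
    refine IsQuotientMap.isIndContained (f := fun _ => (0 : Fin 5)) (fun u v h => absurd rfl h)
      fun x y _ => by_contra fun hne => ?_
    obtain ⟨u, v, huv⟩ := (isModule_univ (G := G)).exists_isTwins _ ⟨x, trivial, y, trivial, hne⟩
      fun a _ b _ c _ d _ => hp a b c d
    exact hno u v huv

theorem P4Good.exists_reduction [Finite V] (S : Set V) (hG : P4Good (G.induce S)) :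
    ∃ T, Relation.ReflTransGen (TwinElimination G) S T ∧ (G.induce T).IsIndContained bull := by
  induction S using WellFoundedLT.induction with
  | ind S ih =>
    by_cases h : ∃ u v, IsTwins (G.induce S) u v
    · obtain ⟨u, v, huv⟩ := h
      have hsub : S \ {(u : V)} ⊆ S := Set.sdiff_subset
      obtain ⟨T, hT, hT'⟩ := ih (S \ {(u : V)}) ⟨hsub, fun h => (h u.2).2 rfl⟩
        (hG.comap (G.induceHomOfLE hsub))
      exact ⟨T, .head ⟨u, v, huv, rfl⟩ hT, hT'⟩
    · push Not at h
      exact ⟨S, .refl, hG.isIndContained_bull_of_no_twins h⟩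

/-! ### Adding twins -/

section Twins

variable {a b c d : V}

/-- Twins form a two-element module, which would have to contain the whole `P₄`. -/
theorem IsInducedP4.not_isTwins (h : IsInducedP4 G a b c d) {x y : V}
    (hx : x ∈ ({a, b, c, d} : Set V)) (hy : y ∈ ({a, b, c, d} : Set V)) : ¬ IsTwins G x y := by
  rw [isTwins_iff]
  rintro ⟨hne, ht⟩
  have hM : IsModule G {x, y} := by
    refine isModule_iff.2 fun w hw => ?_
    simp only [Set.mem_insert_iff, Set.mem_singleton_iff, not_or] at hw
    have := ht w hw.1 hw.2
    rw [G.adj_comm x, G.adj_comm y] at this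
    rintro _ (rfl | rfl) _ (rfl | rfl) <;> tauto
  obtain ⟨h1, h2, h3, -⟩ := hM.mem_of_two_mem h hx hy hne (by simp) (by simp)
  have := h.ab.ne
  have := h.bc.ne
  have := h.ne_ac
  simp only [Set.mem_insert_iff, Set.mem_singleton_iff] at h1 h2 h3
  grind

theorem IsInducedP4.good_of_mem (h : IsInducedP4 G a b c d) {x : V}
    (hx : x ∈ ({a, b, c, d} : Set V)) :
    (G.Adj x b ∨ G.Adj x c) ∧ ¬ (G.Adj x a ∧ G.Adj x d) := by
  rcases hx with rfl | rfl | rfl | rfl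
  · exact ⟨Or.inl h.ab, fun e => h.nad e.2⟩
  · exact ⟨Or.inr h.bc, fun e => h.nbd e.2⟩
  · exact ⟨Or.inl h.bc.symm, fun e => h.nac e.1.symm⟩
  · exact ⟨Or.inr h.cd.symm, fun e => h.nad e.1.symm⟩

theorem IsInducedP4.good_of_isTwins (h : IsInducedP4 G a b c d) {x y : V}
    (hy : y ∈ ({a, b, c, d} : Set V)) (hxy : IsTwins G x y) :
    (G.Adj x b ∨ G.Adj x c) ∧ ¬ (G.Adj x a ∧ G.Adj x d) := by
  by_cases hx : x ∈ ({a, b, c, d} : Set V)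
  · exact h.good_of_mem hx
  simp only [Set.mem_insert_iff, Set.mem_singleton_iff, not_or] at hx
  obtain ⟨-, ht⟩ := isTwins_iff.1 hxy
  have ta := ht a (Ne.symm hx.1)
  have tb := ht b (Ne.symm hx.2.1)
  have tc := ht c (Ne.symm hx.2.2.1)
  have td := ht d (Ne.symm hx.2.2.2)
  rcases hy with rfl | rfl | rfl | rfl
  · exact ⟨Or.inl ((tb h.ab.ne.symm).2 h.ab), fun e => h.nad ((td h.ne_ad.symm).1 e.2)⟩
  · exact ⟨Or.inr ((tc h.bc.ne.symm).2 h.bc), fun e => h.nbd ((td h.ne_bd.symm).1 e.2)⟩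
  · exact ⟨Or.inl ((tb h.bc.ne).2 h.bc.symm), fun e => h.nac ((ta h.ne_ac).1 e.1).symm⟩
  · exact ⟨Or.inr ((tc h.cd.ne).2 h.cd.symm), fun e => h.nad ((ta h.ne_ad).1 e.1).symm⟩

theorem isTwins_symm {u v : V} (h : IsTwins G u v) : IsTwins G v u := by
  rw [isTwins_iff] at h ⊢
  exact ⟨h.1.symm, fun w h1 h2 => (h.2 w h2 h1).symm⟩

/-- Adding a twin preserves `P4Good`. -/
theorem P4Good.of_isTwins {u v : V} (huv : IsTwins G u v) (hG : P4Good (G.induce {u}ᶜ)) :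
    P4Good G := by
  classical
  intro a b c d h x
  by_cases hx : x ∈ ({a, b, c, d} : Set V)
  · exact h.good_of_mem hx
  by_cases hxu : x = u ∧ v ∈ ({a, b, c, d} : Set V)
  · exact h.good_of_isTwins hxu.2 (hxu.1 ▸ huv)
  by_cases hxv : x = v ∧ u ∈ ({a, b, c, d} : Set V)
  · exact h.good_of_isTwins hxv.2 (hxv.1 ▸ isTwins_symm huv)
  have hnot : ¬ (u ∈ ({a, b, c, d} : Set V) ∧ v ∈ ({a, b, c, d} : Set V)) :=
    fun e => h.not_isTwins e.1 e.2 huv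
  obtain ⟨hne, ht⟩ := isTwins_iff.1 huv
  -- Folding `u` onto `v` can change adjacency only for the pair `u, v`, and the cases above ensure
  -- that no needed pair is this one.
  let f : V → ({u}ᶜ : Set V) := fun w => if hw : w = u then ⟨v, hne.symm⟩ else ⟨w, hw⟩
  have hf : ∀ w z, ¬ (w = u ∧ z = v) → ¬ (w = v ∧ z = u) →
      ((G.induce {u}ᶜ).Adj (f w) (f z) ↔ G.Adj w z) := by
    intro w z h1 h2
    simp only [f]
    split_ifs with hw hz hz
    · subst hw hz; simp
    · subst hw
      exact (ht z hz fun e => h1 ⟨rfl, e⟩).symm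
    · subst hz
      have := ht w hw fun e => h2 ⟨e, rfl⟩
      rw [G.adj_comm z, G.adj_comm v] at this
      exact this.symm
    · rfl
  simp only [Set.mem_insert_iff, Set.mem_singleton_iff] at hnot hxu hxv
  have fab := hf a b (by grind) (by grind)
  have fbc := hf b c (by grind) (by grind)
  have fcd := hf c d (by grind) (by grind)
  have fac := hf a c (by grind) (by grind)
  have fad := hf a d (by grind) (by grind)
  have fbd := hf b d (by grind) (by grind)
  have fxa := hf x a (by grind) (by grind)
  have fxb := hf x b (by grind) (by grind)
  have fxc := hf x c (by grind) (by grind)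
  have fxd := hf x d (by grind) (by grind)
  have := hG (f a) (f b) (f c) (f d) ⟨fab.2 h.ab, fbc.2 h.bc, fcd.2 h.cd,
    fun e => h.nac (fac.1 e), fun e => h.nad (fad.1 e), fun e => h.nbd (fbd.1 e)⟩ (f x)
  rwa [fxa, fxb, fxc, fxd] at this

end Twins

theorem TwinElimination.p4Good {S T : Set V} (h : TwinElimination G S T)
    (hT : P4Good (G.induce T)) : P4Good (G.induce S) := by
  obtain ⟨u, v, huv, rfl⟩ := h
  refine P4Good.of_isTwins huv (hT.comap ?_)
  exact
    { toFun := fun w => ⟨w.1, w.1.2, fun e => w.2 (Subtype.ext e)⟩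
      inj' := fun w z e => Subtype.ext (Subtype.ext (Subtype.mk.inj e))
      map_rel_iff' := Iff.rfl }

theorem p4Good_iff_reduces [Finite V] :
    P4Good G ↔ ReducesByTwinsToInducedSubgraphOf G bull := by
  constructor
  · intro hG
    exact P4Good.exists_reduction Set.univ (hG.comap (Embedding.induce Set.univ))
  · rintro ⟨S, hS, ⟨f⟩⟩
    have key : ∀ T, Relation.ReflTransGen (TwinElimination G) T S → P4Good (G.induce T) := by
      intro T hT
      induction hT using Relation.ReflTransGen.head_induction_on with
      | refl => exact bull_p4Good.comap f
      | head h _ ih => exact h.p4Good ih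
    exact (key _ hS).comap (induceUnivIso G).symm.toEmbedding

/-! ### Labels of the modular decomposition tree -/

/-- A maximal strong proper submodule of a strong module that induces a disconnected graph is
anticomplete to the rest of that module. -/
theorem IsSplit.not_adj {t s : Set V} (hsp : IsSplit G t) (ht : IsStrongModule G t)
    (hs : IsModule G s) (hst : s ⊂ t)
    (hmax : ∀ r, IsStrongModule G r → s ⊂ r → ¬ r ⊂ t)
    {u v : V} (hu : u ∈ s) (hv : v ∈ t) (hvs : v ∉ s) : ¬ G.Adj u v := by
  intro huv
  let R : V → V → Prop := fun x y => x ∈ t ∧ y ∈ t ∧ G.Adj x y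
  have hRs : ∀ {x y}, Relation.ReflTransGen R x y → Relation.ReflTransGen R y x := by
    intro x y h
    induction h with
    | refl => exact .refl
    | tail _ h ih => exact .head ⟨h.2.1, h.1, h.2.2.symm⟩ ih
  -- The component of `u` in the graph induced on `t`. It will be a strong module strictly between
  -- `s` and `t`, against maximality.
  let K : Set V := {y | Relation.ReflTransGen R u y}
  have huK : u ∈ K := .refl
  have hut : u ∈ t := hst.subset hu
  have hcl : ∀ {x y}, x ∈ K → x ∈ t → y ∈ t → G.Adj x y → y ∈ K :=
    fun hx hxt hyt e => hx.tail ⟨hxt, hyt, e⟩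
  have hKt : K ⊆ t := fun y hy => by
    rcases hy.cases_tail with rfl | ⟨z, _, h⟩
    exacts [hut, h.2.1]
  have hvK : v ∈ K := hcl huK hut hv huv
  have hKne : ∃ q ∈ t, q ∉ K := by
    obtain ⟨A, B, ⟨p, hp⟩, ⟨q, hq⟩, hAB, rfl, hn⟩ := hsp
    rw [Set.disjoint_left] at hAB
    by_cases huA : u ∈ A
    · refine ⟨q, Or.inr hq, fun hqK => ?_⟩
      have : ∀ {y}, Relation.ReflTransGen R u y → y ∈ A := fun {y} h => by
        induction h with
        | refl => exact huA
        | tail _ h ih => exact h.2.1.resolve_right fun hB => hn _ ih _ hB h.2.2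
      exact hAB (this hqK) hq
    · refine ⟨p, Or.inl hp, fun hpK => ?_⟩
      have : ∀ {y}, Relation.ReflTransGen R u y → y ∈ B := fun {y} h => by
        induction h with
        | refl => exact hut.resolve_left huA
        | tail _ h ih => exact h.2.1.resolve_left fun hA => hn _ hA _ ih h.2.2.symm
      exact hAB hp (this hpK)
  obtain ⟨q, hqt, hqK⟩ := hKne
  have hKss : K ⊂ t := ⟨hKt, fun h => hqK (h hqt)⟩
  have hKmod : IsModule G K := by
    refine isModule_iff.2 fun w hw x hx y hy e => ?_
    by_cases hwt : w ∈ t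
    · exact absurd (hcl hx (hKt hx) hwt e.symm) hw
    · exact isModule_iff.1 ht.2.1 w hwt x (hKt hx) y (hKt hy) e
  have hcross : ∀ {M : Set V} {x y}, Relation.ReflTransGen R x y → x ∈ K → x ∈ M → y ∉ M →
      ∃ x' ∈ M, ∃ y' ∈ K, y' ∉ M ∧ R x' y' := by
    intro M x y h hxK hx hy
    induction h with
    | refl => exact absurd hx hy
    | @tail y z h' h ih =>
      by_cases hyM : y ∈ M
      · exact ⟨y, hyM, z, (hxK.trans h').tail h, hy, h⟩
      · exact ih hyM
  have hKstrong : IsStrongModule G K := by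
    refine ⟨⟨u, huK⟩, hKmod, fun M hM => ?_⟩
    by_contra hcon
    simp only [not_or] at hcon
    obtain ⟨h1, h2, h3⟩ := hcon
    obtain ⟨p, hpK, hpM⟩ := Set.nonempty_iff_ne_empty.2 h1
    obtain ⟨w, hwK, hwM⟩ := Set.not_subset.1 h2
    obtain ⟨r, hrM, hrK⟩ := Set.not_subset.1 h3
    -- If `M` overlaps the component, some edge inside `K` leaves `M` at `y`. Then `y` sees all of
    -- `M`, including `r ∉ K`: if `r ∈ t` it belongs to the component, and if not, `M` overlaps the
    -- strong module `t`.
    obtain ⟨x, hxM, y, hyK, hyM, hxt, hyt, hxy⟩ :=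
      hcross ((hRs hpK).trans hwK : Relation.ReflTransGen R p w) hpK hpM hwM
    have hyr : G.Adj y r := (hM.adj_iff hyM hxM hrM).1 hxy.symm
    by_cases hrt : r ∈ t
    · exact hrK (hcl hyK hyt hrt hyr)
    · rcases ht.2.2 M hM with h | h | h
      · exact Set.notMem_empty p (h ▸ ⟨hKt hpK, hpM⟩)
      · exact hwM (h (hKt hwK))
      · exact hrt (h hrM)
  rcases hKstrong.2.2 s hs with h | h | h
  · exact Set.notMem_empty u (h ▸ ⟨huK, hu⟩)
  · exact hvs (h hvK)
  · exact hmax K hKstrong ⟨h, fun h' => hvs (h' hvK)⟩ hKss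

theorem ModularNode.label_eq_bot_of_isSplit (t : ModularNode G) (h : IsSplit G t.1) :
    t.label = ⊥ := by
  ext a b
  simp only [bot_adj, iff_false]
  intro hab
  obtain ⟨hne, u, hu, v, hv, huv⟩ := (t.label_adj_iff_exists a b).1 hab
  refine h.not_adj t.2 a.1.2.2.1 a.2.lt (fun r hr h1 h2 => ?_) hu (b.2.le hv) (fun hva => ?_) huv
  · exact a.2.2 (c := ⟨r, hr⟩) h1 h2
  · exact Set.notMem_empty v (ModularNode.child_disjoint a b hne ▸ ⟨hva, hv⟩)

/-- `G` and `Gᶜ` have the same strong modules, so the disconnected case applies in the complement.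
-/
theorem ModularNode.label_eq_top_of_isSplit_compl (t : ModularNode G) (h : IsSplit Gᶜ t.1) :
    t.label = ⊤ := by
  ext a b
  simp only [top_adj]
  refine ⟨fun e => e.1, fun hne => ⟨hne, fun u hu v hv => ?_⟩⟩
  have hva : v ∉ (a.1 : Set V) := fun hva =>
    Set.notMem_empty v (ModularNode.child_disjoint a b hne ▸ ⟨hva, hv⟩)
  have := h.not_adj (isStrongModule_compl_iff.2 t.2) a.1.2.2.1.compl a.2.lt
    (fun r hr h1 h2 => a.2.2 (c := ⟨r, isStrongModule_compl_iff.1 hr⟩) h1 h2) hu (b.2.le hv) hva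
  rw [compl_adj] at this
  by_contra huv
  exact this ⟨fun e => hva (e ▸ hu), huv⟩

theorem ModularNode.nontrivial_of_isInternal {t : ModularNode G} (ht : t.IsInternal) :
    (t : Set V).Nontrivial := by
  obtain ⟨s⟩ := ht
  obtain ⟨x, hx⟩ := s.1.2.1
  obtain ⟨y, hy, hys⟩ := Set.exists_of_ssubset (show (s.1 : Set V) ⊂ t from s.2.lt)
  exact ⟨x, s.2.le hx, y, hy, fun e => hys (e ▸ hx)⟩

theorem ModularNode.isCliqueOrIndependent_label [Finite V] {t : ModularNode G}
    (ht : t.IsInternal) (hP : IsP4Free G (t : Set V)) : IsCliqueOrIndependent t.label := by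
  rcases hP.isSplit_or_isSplit_compl (Set.toFinite _) (nontrivial_of_isInternal ht) with h | h
  · exact Or.inr (t.label_eq_bot_of_isSplit h)
  · exact Or.inl (t.label_eq_top_of_isSplit_compl h)

theorem P4Good.isStrongModule_fiber (hG : P4Good G) {a b c d : V} (h : IsInducedP4 G a b c d)
    (x : V) : IsStrongModule G {y | p4Class G a b c d y = p4Class G a b c d x} := by
  refine ⟨⟨x, rfl⟩, (hG.isQuotientMap_p4Class h).isModule_fiber _, fun M hM => ?_⟩
  by_contra hcon
  simp only [not_or] at hcon
  obtain ⟨h1, h2, h3⟩ := hcon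
  obtain ⟨p, hp, hpM⟩ := Set.nonempty_iff_ne_empty.2 h1
  obtain ⟨r, hrM, hr⟩ := Set.not_subset.1 h3
  rw [hM.eq_univ_of_p4Class_ne hG h hpM hrM fun e => hr (e.symm.trans hp)] at h2
  exact h2 (Set.subset_univ _)

theorem P4Good.label_isIndContained_bull (hG : P4Good G) {t : ModularNode G} (ht : t.IsRoot)
    {a b c d : V} (h : IsInducedP4 G a b c d) : t.label.IsIndContained bull := by
  choose rep hrep using fun s : t.Child => s.1.2.1
  have ht' : (t : Set V) = Set.univ := ht
  have hlt : ∀ s : t.Child, (s.1 : Set V) ≠ Set.univ := fun s e =>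
    s.2.lt.ne (Subtype.ext (e.trans ht'.symm))
  refine IsQuotientMap.isIndContained (f := fun s => p4Class G a b c d (rep s)) ?_ ?_
  · intro s s' hne
    rw [← hG.isQuotientMap_p4Class h _ _ hne]
    exact ⟨fun e => e.2 _ (hrep s) _ (hrep s'), fun e => (t.label_adj_iff_exists s s').2
      ⟨fun e' => hne (e' ▸ rfl), _, hrep s, _, hrep s', e⟩⟩
  -- Each child of the root is exactly one class: being proper it meets only one, and that class is
  -- itself a proper strong module, so maximality of the child gives equality.
  · have key : ∀ s : t.Child,
        (s.1 : Set V) = {y | p4Class G a b c d y = p4Class G a b c d (rep s)} := by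
      intro s
      let K : ModularNode G := ⟨_, hG.isStrongModule_fiber h (rep s)⟩
      have hsK : s.1 ≤ K := fun y hy => by_contra fun hne =>
        hlt s (s.1.2.2.1.eq_univ_of_p4Class_ne hG h hy (hrep s) hne)
      have hKt : K < t := by
        refine lt_of_le_of_ne (fun y _ => ht'.symm ▸ trivial) fun e => ?_
        exact hG.p4Class_fiber_ne_univ h _ ((congrArg Subtype.val e).trans ht')
      rcases hsK.lt_or_eq with h' | h'
      · exact absurd hKt (s.2.2 h')
      · exact congrArg Subtype.val h'
    intro s s' e
    refine Subtype.ext (Subtype.ext ?_)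
    rw [key s, key s']
    exact congrArg (fun i => {y | p4Class G a b c d y = i}) e

theorem ModularNode.exists_child_of_mem [Finite V] {t : ModularNode G}
    (ht : (t : Set V).Nontrivial) {x : V} (hx : x ∈ (t : Set V)) :
    ∃ s : t.Child, x ∈ (s.1 : Set V) := by
  let l : ModularNode G := ⟨{x}, Set.singleton_nonempty x, isModule_singleton x, fun M _ => by
    by_cases h : x ∈ M
    · exact Or.inr (Or.inl (by simpa using h))
    · exact Or.inl (by simpa using h)⟩
  have hlt : l < t := by
    refine lt_of_le_of_ne (Set.singleton_subset_iff.2 hx) fun e => ?_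
    rw [← e] at ht
    exact Set.not_nontrivial_singleton ht
  obtain ⟨s, hs, hst⟩ := exists_le_covBy_of_lt hlt
  exact ⟨⟨s, hst⟩, hs rfl⟩

/-- Since the path vertices have distinct images, the `P₄` passes to `H`. Adjacency in `H` lifts
back, as it forces distinct images; if `x` shares the image of one end, seeing the other would make
the end images adjacent. -/
theorem IsQuotientMap.good {W : Type*} {H : SimpleGraph W} {f : V → W}
    (hf : IsQuotientMap G H f) (hH : P4Good H) {a b c d : V} (h : IsInducedP4 G a b c d)
    (hab : f a ≠ f b) (hac : f a ≠ f c) (had : f a ≠ f d) (hbc : f b ≠ f c) (hbd : f b ≠ f d)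
    (hcd : f c ≠ f d) (x : V) :
    (G.Adj x b ∨ G.Adj x c) ∧ ¬ (G.Adj x a ∧ G.Adj x d) := by
  have nad : ¬ H.Adj (f a) (f d) := fun e => h.nad ((hf _ _ had).2 e)
  have h' : IsInducedP4 H (f a) (f b) (f c) (f d) :=
    ⟨(hf _ _ hab).1 h.ab, (hf _ _ hbc).1 h.bc, (hf _ _ hcd).1 h.cd,
      fun e => h.nac ((hf _ _ hac).2 e), nad, fun e => h.nbd ((hf _ _ hbd).2 e)⟩
  obtain ⟨h1, h2⟩ := hH _ _ _ _ h' (f x)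
  refine ⟨h1.imp (fun e => (hf _ _ e.ne).2 e) (fun e => (hf _ _ e.ne).2 e), ?_⟩
  rintro ⟨ea, ed⟩
  by_cases hxa : f x = f a
  · exact nad (hxa ▸ (hf x d (hxa ▸ had)).1 ed)
  by_cases hxd : f x = f d
  · exact nad (hxd ▸ (hf x a hxa).1 ea).symm
  exact h2 ⟨(hf _ _ hxa).1 ea, (hf _ _ hxd).1 ed⟩

/-- In a minimal node containing the `P₄`, no child holds two of its vertices, since it would hold
all four. The label thus has a `P₄` and is neither complete nor edgeless, so the node is the root
and `G` maps onto part of the Bull. -/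
theorem p4Good_of_labels [Finite V]
    (hl : ∀ t : ModularNode G, t.IsInternal →
      (t.IsRoot → t.label.IsIndContained bull ∨ IsCliqueOrIndependent t.label) ∧
      (¬ t.IsRoot → IsCliqueOrIndependent t.label)) : P4Good G := by
  intro a b c d h x
  have : Nonempty V := ⟨a⟩
  obtain ⟨t, ⟨hS, hmin⟩⟩ := exists_minimal_of_wellFoundedLT
    (fun t : ModularNode G => ({a, b, c, d} : Set V) ⊆ t)
    ((ModularNode.exists_isRoot G).imp fun t ht => by
      rw [show (t : Set V) = Set.univ from ht]; exact Set.subset_univ _)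
  have hnt : (t : Set V).Nontrivial := ⟨a, hS (by simp), b, hS (by simp), h.ab.ne⟩
  choose σ hσ using fun y : (t : Set V) => ModularNode.exists_child_of_mem hnt y.2
  have hadj : ∀ u v : (t : Set V), σ u ≠ σ v → (G.Adj u v ↔ t.label.Adj (σ u) (σ v)) :=
    fun u v hne => ⟨fun e => (t.label_adj_iff_exists _ _).2 ⟨hne, u, hσ u, v, hσ v, e⟩,
      fun e => e.2 u (hσ u) v (hσ v)⟩
  have hne : ∀ u v : (t : Set V), (u : V) ∈ ({a, b, c, d} : Set V) →
      (v : V) ∈ ({a, b, c, d} : Set V) → (u : V) ≠ v → σ u ≠ σ v := by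
    intro u v hu hv huv e
    have hvu := hσ v
    rw [← e] at hvu
    obtain ⟨h1, h2, h3, h4⟩ := (σ u).1.2.2.1.mem_of_two_mem h hu hv huv (hσ u) hvu
    have hsub : ({a, b, c, d} : Set V) ⊆ (σ u).1 := by
      rintro y (rfl | rfl | rfl | rfl) <;> assumption
    exact (σ u).2.lt.not_ge (hmin hsub (σ u).2.le)
  let a' : (t : Set V) := ⟨a, hS (by simp)⟩
  let b' : (t : Set V) := ⟨b, hS (by simp)⟩
  let c' : (t : Set V) := ⟨c, hS (by simp)⟩
  let d' : (t : Set V) := ⟨d, hS (by simp)⟩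
  have nab : σ a' ≠ σ b' := hne a' b' (by simp [a']) (by simp [b']) h.ab.ne
  have nac : σ a' ≠ σ c' := hne a' c' (by simp [a']) (by simp [c']) h.ne_ac
  have nad : σ a' ≠ σ d' := hne a' d' (by simp [a']) (by simp [d']) h.ne_ad
  have nbc : σ b' ≠ σ c' := hne b' c' (by simp [b']) (by simp [c']) h.bc.ne
  have nbd : σ b' ≠ σ d' := hne b' d' (by simp [b']) (by simp [d']) h.ne_bd
  have ncd : σ c' ≠ σ d' := hne c' d' (by simp [c']) (by simp [d']) h.cd.ne
  have hnot : ¬ IsCliqueOrIndependent t.label := by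
    rintro (e | e)
    · exact h.nac ((hadj a' c' nac).2 (by rw [e]; exact nac))
    · have := (hadj a' b' nab).1 h.ab
      rw [e] at this
      exact this
  have hint : t.IsInternal := ⟨σ a'⟩
  obtain ⟨hroot, hnonroot⟩ := hl t hint
  have hr : t.IsRoot := by_contra fun hr => hnot (hnonroot hr)
  obtain ⟨φ⟩ := (hroot hr).resolve_right hnot
  have ht : ∀ y, y ∈ (t : Set V) := fun y => (show (t : Set V) = Set.univ from hr) ▸ trivial
  have hf : IsQuotientMap G bull fun y => φ (σ ⟨y, ht y⟩) := fun u v huv => by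
    rw [φ.map_adj_iff]
    exact hadj ⟨u, ht u⟩ ⟨v, ht v⟩ fun e => huv (congrArg φ e)
  exact hf.good bull_p4Good h (φ.injective.ne nab) (φ.injective.ne nac) (φ.injective.ne nad)
    (φ.injective.ne nbc) (φ.injective.ne nbd) (φ.injective.ne ncd) x

theorem p4Good_iff_labels [Finite V] : P4Good G ↔
    ∀ t : ModularNode G, t.IsInternal →
      (t.IsRoot → t.label.IsIndContained bull ∨ IsCliqueOrIndependent t.label) ∧
      (¬ t.IsRoot → IsCliqueOrIndependent t.label) := by
  refine ⟨fun hG t ht => ⟨fun hr => ?_, fun hr => ?_⟩, p4Good_of_labels⟩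
  · by_cases hp : ∃ a b c d, IsInducedP4 G a b c d
    · obtain ⟨a, b, c, d, h⟩ := hp
      exact Or.inl (hG.label_isIndContained_bull hr h)
    · push Not at hp
      exact Or.inr (ModularNode.isCliqueOrIndependent_label ht fun a _ b _ c _ d _ => hp a b c d)
  · exact ModularNode.isCliqueOrIndependent_label ht (t.2.2.1.isP4Free hG hr)

end DHCoDH

theorem mainTheorem3 {V : Type*} [Finite V] (G : SimpleGraph V) :
    (DHCoDH.IsDHCoDH G ↔ DHCoDH.ReducesByTwinsToInducedSubgraphOf G DHCoDH.bull) ∧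
    (DHCoDH.IsDHCoDH G ↔
      ∀ t : DHCoDH.ModularNode G, t.IsInternal →
        (t.IsRoot →
          t.label.IsIndContained DHCoDH.bull ∨ DHCoDH.IsCliqueOrIndependent t.label) ∧
        (¬ t.IsRoot → DHCoDH.IsCliqueOrIndependent t.label)) :=
  ⟨DHCoDH.isDHCoDH_iff_p4Good.trans DHCoDH.p4Good_iff_reduces,
    DHCoDH.isDHCoDH_iff_p4Good.trans DHCoDH.p4Good_iff_labels⟩
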